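/- Let $\theta\in\mathbb{R}$. Let $A_\theta$ be the universal $C^*$-algebra with generators $U$ and $V$ subject to the relations $U^*U=I$, $V^*V=VV^*=I$ and $VU=e^{2\pi i\theta}UV$; that is, $A_\theta$ is the completion of the algebra of polynomials $a$ in $U$, $V$ and their adjoints with respect to the maximal (semi)norm $\|a\|_{\max}=\sup_\pi\|\pi(a)\|$, where $\pi$ ranges over all representations of the relations by bounded operators on Hilbert spaces. Let $W$ be the unilateral shift $We_k=e_{k+1}$ on $\ell^2(\mathbb{Z}_{\ge 0})$ and let $\mathcal{T}=C^*(W)$ be the Toeplitz algebra. Then there is exactly one action $\Theta$ of $\mathbb{Z}$ on $\mathcal{T}$ by $*$-automorphisms such that $\Theta_n(W)=e^{2\pi i n\theta}W$ for all $n\in\mathbb{Z}$. Moreover, if $\mathcal{T}\rtimes_\theta\mathbb{Z}$ denotes the (full) crossed product of $\mathcal{T}$ by this action, i.e. the $C^*$-algebra generated by $\mathcal{T}$ and a unitary representation $n\mapsto u_n$ of $\mathbb{Z}$ whose norm is the supremum over all covariant representations, so that $u_n b u_n^*=\Theta_n(b)$ for all $b\in\mathcal{T}$, then $$A_\theta\cong\mathcal{T}\rtimes_\theta\mathbb{Z}$$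 as $C^*$-algebras, by a $*$-isomorphism that sends $U$ to $W\in\mathcal{T}$ and $V$ to $u_1$. -/

import Mathlib

universe u

open scoped ENNReal

noncomputable section

/-! ### The quantum solid torus as a universal C⋆-algebra

The universal C⋆-algebra on generators subject to relations is the C⋆-algebra generated by the
generators in the direct sum of all representations of the relations on Hilbert spaces.  The norm
of a polynomial `a` in the generators and their adjoints is thus the supremum of `‖π a‖` over all
representations `π`, and the algebra is the completion of these polynomials (modulo those of norm
zero).  Omitting the zero Hilbert space does not change this supremum. -/

/-- A representation of the defining relations of the quantum solid torus: bounded operators `U`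
and `V` on a (nonzero) complex Hilbert space such that `U` is an isometry, `V` is unitary and
`V U = exp (2 π i θ) U V`. Since the algebra generated by two elements is separable, Hilbert
spaces in `Type` suffice to compute the maximal norm. -/
structure SolidTorusRep (θ : ℝ) : Type 1 where
  /-- the Hilbert space -/
  H : Type
  [normedAddCommGroup : NormedAddCommGroup H]
  [innerProductSpace : InnerProductSpace ℂ H]
  [completeSpace : CompleteSpace H]
  [nontrivial : Nontrivial H]
  /-- the isometry -/
  U : H →L[ℂ] H
  /-- the unitary -/
  V : H →L[ℂ] H
  star_U_mul_U : star U * U = 1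
  star_V_mul_V : star V * V = 1
  V_mul_star_V : V * star V = 1
  V_mul_U : V * U = Complex.exp (2 * Real.pi * Complex.I * θ) • (U * V)

namespace SolidTorusRep

attribute [instance] normedAddCommGroup innerProductSpace completeSpace nontrivial

end SolidTorusRep

/-- In a C⋆-algebra, isometries have norm at most one. -/
theorem norm_le_one_of_star_mul_self_eq_one {B : Type*} [CStarAlgebra B] {x : B}
    (h : star x * x = 1) : ‖x‖ ≤ 1 := by
  rcases subsingleton_or_nontrivial B with _ | _
  · simp [Subsingleton.elim x 0]
  · have h1 : ‖x‖ * ‖x‖ = 1 := by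
      rw [← CStarRing.norm_star_mul_self, h, norm_one]
    nlinarith [norm_nonneg x]

/-- The `ℓ^∞`-product of a family of nonzero unital C⋆-algebras, with pointwise operations and
the supremum norm, is a unital C⋆-algebra. -/
def lpInftyCStarAlgebra {I : Type*} (B : I → Type*) [∀ i, Nontrivial (B i)]
    [∀ i, CStarAlgebra (B i)] : CStarAlgebra (lp B ∞) where

namespace QuantumSolidTorus

variable (θ : ℝ)

/-- The C⋆-algebra of bounded operators on the direct sum of all representations that are
diagonal with respect to this sum, i.e. the `ℓ^∞`-product of the algebras `B(H)`. -/
def Ambient : Type 1 := lp (fun π : SolidTorusRep θ => π.H →L[ℂ] π.H) ∞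

instance : CStarAlgebra (Ambient θ) := lpInftyCStarAlgebra _

/-- The generator `U` of the universal algebra: the family of all the isometries `π.U`. -/
def ambientU : Ambient θ :=
  ⟨fun π => π.U, memℓp_infty ⟨1, by
    rintro _ ⟨π, rfl⟩
    exact norm_le_one_of_star_mul_self_eq_one π.star_U_mul_U⟩⟩

/-- The generator `V` of the universal algebra: the family of all the unitaries `π.V`. -/
def ambientV : Ambient θ :=
  ⟨fun π => π.V, memℓp_infty ⟨1, by
    rintro _ ⟨π, rfl⟩
    exact norm_le_one_of_star_mul_self_eq_one π.star_V_mul_V⟩⟩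

end QuantumSolidTorus

/-- The quantum solid torus `A_θ`: the universal (unital) C⋆-algebra with generators `U` and `V`
such that `U⋆ U = 1`, `V⋆ V = V V⋆ = 1` and `V U = exp (2 π i θ) U V`. -/
def QuantumSolidTorus (θ : ℝ) : Type 1 :=
  ↥(StarAlgebra.adjoin ℂ
    {QuantumSolidTorus.ambientU θ, QuantumSolidTorus.ambientV θ}).topologicalClosure

instance (θ : ℝ) : CStarAlgebra (QuantumSolidTorus θ) :=
  StarSubalgebra.cstarAlgebra
    (StarAlgebra.adjoin ℂ
      {QuantumSolidTorus.ambientU θ, QuantumSolidTorus.ambientV θ}).topologicalClosure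
    (h_closed := StarSubalgebra.isClosed_topologicalClosure _)

namespace QuantumSolidTorus

/-- The generating isometry `U` of `A_θ`. -/
def U (θ : ℝ) : QuantumSolidTorus θ :=
  ⟨ambientU θ, StarSubalgebra.le_topologicalClosure _
    (StarAlgebra.subset_adjoin ℂ _ (Set.mem_insert _ _))⟩

/-- The generating unitary `V` of `A_θ`. -/
def V (θ : ℝ) : QuantumSolidTorus θ :=
  ⟨ambientV θ, StarSubalgebra.le_topologicalClosure _
    (StarAlgebra.subset_adjoin ℂ _ (Set.mem_insert_of_mem _ rfl))⟩

end QuantumSolidTorus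

/-! ### The Toeplitz algebra -/

/-- The Hilbert space `ℓ²(ℤ_{≥ 0})`. -/
abbrev EllTwo : Type := lp (fun _ : ℕ => ℂ) 2

/-- The sequence `(0, x 0, x 1, …)`. -/
def shiftSeq (x : ℕ → ℂ) : ℕ → ℂ
  | 0 => 0
  | n + 1 => x n

theorem hasSum_norm_shiftSeq (x : EllTwo) :
    HasSum (fun n => ‖shiftSeq x n‖ ^ (2 : ℝ≥0∞).toReal) (‖x‖ ^ (2 : ℝ≥0∞).toReal) := by
  have h := lp.hasSum_norm (p := 2) (by simp) x
  rw [← hasSum_nat_add_iff' 1]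
  simpa [shiftSeq] using h

/-- The unilateral shift `W` on `ℓ²(ℤ_{≥ 0})`, as a linear isometry. -/
def unilateralShiftₗᵢ : EllTwo →ₗᵢ[ℂ] EllTwo where
  toFun x := ⟨shiftSeq x, memℓp_gen (hasSum_norm_shiftSeq x).summable⟩
  map_add' x y := by
    ext n
    change shiftSeq (x + y : EllTwo) n = shiftSeq x n + shiftSeq y n
    cases n <;> simp [shiftSeq]
  map_smul' c x := by
    ext n
    cases n <;> simp [shiftSeq]
  norm_map' x := by
    have h1 := (lp.hasSum_norm (p := 2) (by simp)
      (⟨shiftSeq x, memℓp_gen (hasSum_norm_shiftSeq x).summable⟩ : EllTwo)).unique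
        (hasSum_norm_shiftSeq x)
    exact (Real.rpow_left_inj (norm_nonneg _) (norm_nonneg _) (by simp)).1 h1

/-- The unilateral shift `W` as a bounded operator on `ℓ²(ℤ_{≥ 0})`. -/
def unilateralShift : EllTwo →L[ℂ] EllTwo := unilateralShiftₗᵢ.toContinuousLinearMap

/-- The unilateral shift satisfies `W e_k = e_{k+1}`. -/
theorem unilateralShift_single (k : ℕ) :
    unilateralShift (lp.single 2 k (1 : ℂ)) = lp.single 2 (k + 1) (1 : ℂ) := by
  ext n
  change shiftSeq (lp.single 2 k (1 : ℂ) : EllTwo) n = _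
  cases n with
  | zero => simp [shiftSeq, lp.single_apply]
  | succ n => simp [shiftSeq, lp.single_apply, Pi.single_apply]

/-- The Toeplitz algebra `𝒯`: the C⋆-algebra of operators on `ℓ²(ℤ_{≥ 0})` generated by the
unilateral shift. -/
def ToeplitzAlgebra : Type :=
  ↥(StarAlgebra.elemental ℂ unilateralShift)

instance : CStarAlgebra ToeplitzAlgebra :=
  inferInstanceAs (CStarAlgebra ↥(StarAlgebra.elemental ℂ unilateralShift))

/-- The unilateral shift as an element of the Toeplitz algebra. -/
def ToeplitzAlgebra.W : ToeplitzAlgebra :=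
  ⟨unilateralShift, StarAlgebra.elemental.self_mem ℂ unilateralShift⟩

/-! ### Crossed products by discrete groups -/

/-- A covariant representation of an action `α` of a discrete group `G` on a unital C⋆-algebra
`A`: a (nonzero) Hilbert space with a unital ⋆-representation `ρ` of `A` and a unitary
representation `V` of `G` such that `ρ (α_g a) = V_g (ρ a) V_g⋆`. -/
structure CovariantRep {A G : Type u} [CStarAlgebra A] [Group G] (α : G →* (A ≃⋆ₐ[ℂ] A)) :
    Type (u + 1) where
  /-- the Hilbert space -/
  H : Type u
  [normedAddCommGroup : NormedAddCommGroup H]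
  [innerProductSpace : InnerProductSpace ℂ H]
  [completeSpace : CompleteSpace H]
  [nontrivial : Nontrivial H]
  /-- the representation of the algebra -/
  ρ : A →⋆ₐ[ℂ] (H →L[ℂ] H)
  /-- the representation of the group -/
  V : G →* unitary (H →L[ℂ] H)
  covariant : ∀ (g : G) (a : A),
    ρ (α g a) = (V g : H →L[ℂ] H) * ρ a * star (V g : H →L[ℂ] H)

namespace CovariantRep

attribute [instance] normedAddCommGroup innerProductSpace completeSpace nontrivial

end CovariantRep

namespace CrossedProduct

variable {A G : Type u} [CStarAlgebra A] [Group G] (α : G →* (A ≃⋆ₐ[ℂ] A))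

/-- The `ℓ^∞`-product of the algebras `B(H)` over all covariant representations. -/
def Ambient : Type (u + 1) := lp (fun π : CovariantRep α => π.H →L[ℂ] π.H) ∞

instance : CStarAlgebra (Ambient α) := lpInftyCStarAlgebra _

/-- The image of `a : A` in the direct sum of all covariant representations. -/
def ambientOf (a : A) : Ambient α :=
  ⟨fun π => π.ρ a, memℓp_infty ⟨‖a‖, by
    rintro _ ⟨π, rfl⟩
    exact NonUnitalStarAlgHom.norm_apply_le π.ρ a⟩⟩

/-- The image of `g : G` in the direct sum of all covariant representations. -/
def ambientUnitary (g : G) : Ambient α :=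
  ⟨fun π => (π.V g : π.H →L[ℂ] π.H), memℓp_infty ⟨1, by
    rintro _ ⟨π, rfl⟩
    exact norm_le_one_of_star_mul_self_eq_one (Unitary.star_mul_self_of_mem (π.V g).2)⟩⟩

end CrossedProduct

/-- The (full) crossed product `A ⋊_α G` of a unital C⋆-algebra by a discrete group: the
C⋆-algebra generated by the copies of `A` and `G` in the direct sum of all covariant
representations, i.e. the completion of the finite sums `∑ a_g u_g` in the norm
`sup ‖∑ ρ (a_g) V_g‖`, the supremum being over all covariant representations `(ρ, V)`. -/
def CrossedProduct {A G : Type u} [CStarAlgebra A] [Group G] (α : G →* (A ≃⋆ₐ[ℂ] A)) :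
    Type (u + 1) :=
  ↥(StarAlgebra.adjoin ℂ (Set.range (CrossedProduct.ambientOf α) ∪
    Set.range (CrossedProduct.ambientUnitary α))).topologicalClosure

instance {A G : Type u} [CStarAlgebra A] [Group G] (α : G →* (A ≃⋆ₐ[ℂ] A)) :
    CStarAlgebra (CrossedProduct α) :=
  StarSubalgebra.cstarAlgebra
    (StarAlgebra.adjoin ℂ (Set.range (CrossedProduct.ambientOf α) ∪
      Set.range (CrossedProduct.ambientUnitary α))).topologicalClosure
    (h_closed := StarSubalgebra.isClosed_topologicalClosure _)

namespace CrossedProduct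

variable {A G : Type u} [CStarAlgebra A] [Group G] (α : G →* (A ≃⋆ₐ[ℂ] A))

/-- The canonical map `A → A ⋊_α G`. -/
def of (a : A) : CrossedProduct α :=
  ⟨ambientOf α a, StarSubalgebra.le_topologicalClosure _
    (StarAlgebra.subset_adjoin ℂ _ (Or.inl ⟨a, rfl⟩))⟩

/-- The canonical unitary of `A ⋊_α G` that implements `α g`. -/
def implementer (g : G) : CrossedProduct α :=
  ⟨ambientUnitary α g, StarSubalgebra.le_topologicalClosure _
    (StarAlgebra.subset_adjoin ℂ _ (Or.inr ⟨g, rfl⟩))⟩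

end CrossedProduct

/-- The action `Θ` of `ℤ` on the Toeplitz algebra is the rotation action of angle `θ`:
`Θ_n W = exp (2 π i n θ) W` for all `n`. -/
def IsToeplitzRotation (θ : ℝ)
    (Θ : Multiplicative ℤ →* (ToeplitzAlgebra ≃⋆ₐ[ℂ] ToeplitzAlgebra)) : Prop :=
  ∀ n : ℤ, Θ (Multiplicative.ofAdd n) ToeplitzAlgebra.W =
    Complex.exp (2 * Real.pi * Complex.I * n * θ) • ToeplitzAlgebra.W

end

/-!
The isomorphism compares universal properties: `A_θ` is universal for pairs `(U, V)` of an isometry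
and a unitary with `V U = exp (2 π i θ) U V`, and `𝒯 ⋊ ℤ` is universal for covariant pairs `(ρ, V)`.
A covariant pair restricts to the pair `(ρ W, V 1)`. The converse direction needs Coburn's theorem
(`ToeplitzAlgebra.exists_starAlgHom_of_isometry`): for every isometry `U` on a Hilbert space there
is a representation of the concrete algebra `𝒯` that maps the unilateral shift `W` to `U`. The same
theorem, applied to the isometries `exp (2 π i n θ) W`, provides the rotation action; everything
else follows because ⋆-homomorphisms are determined on generators.

Coburn's theorem is proved with the Poisson transform, which treats all isometries uniformly and
thus makes the Wold decomposition unnecessary. For `‖T‖ < 1` on `H` and `D = (1 - T T⋆)^{1/2}`,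
the map `x ↦ (D T⋆ⁿ x)ₙ` is an isometry from `H` to `ℓ²(ℕ, H)`, by telescoping. In coordinates with
respect to a Hilbert basis of `H` it becomes an isometry `K` to a direct sum of copies of `ℓ²(ℕ)`
that intertwines `T⋆` with the diagonal operator of `W⋆`. Compressing diagonal operators by `K`
gives a contractive linear map `Φ` with `Φ (Wᵐ W⋆ⁿ) = Tᵐ T⋆ⁿ` (`exists_poissonTransform`). Because
`U⋆ U = 1`, the monomials `Uᵐ U⋆ⁿ` span the ⋆-algebra generated by `U`; taking `T = r U` with
`r → 1` shows that every ⋆-polynomial satisfies `‖p (U)‖ ≤ ‖p (W)‖` (`norm_snd_le_norm_fst_of_poisson`).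
This estimate says that the closed ⋆-algebra generated by `(W, U)` in the product is the graph of
a ⋆-homomorphism (`StarAlgebra.elemental.exists_starAlgHom_of_norm_le`).
-/

open scoped CStarAlgebra

noncomputable section

/-! ### Homomorphisms on the algebra generated by an isometry -/

section
variable {A B : Type*} [CStarAlgebra A] [CStarAlgebra B]

/-- The span of the monomials `xᵐ x⋆ⁿ` is a left module over the ⋆-algebra generated by an isometry
`x`, since `x⋆` cancels against a power of `x`. -/
theorem StarAlgebra.adjoin_singleton_le_span_of_isometry {x : A} (hx : star x * x = 1) :
    (StarAlgebra.adjoin ℂ {x} : Set A) ⊆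
      Submodule.span ℂ (Set.range fun p : ℕ × ℕ => x ^ p.1 * star x ^ p.2) := by
  set M := Submodule.span ℂ (Set.range fun p : ℕ × ℕ => x ^ p.1 * star x ^ p.2)
  have mem (m n : ℕ) : x ^ m * star x ^ n ∈ M := Submodule.subset_span ⟨(m, n), rfl⟩
  have key (z : A) (hz : ∀ m n : ℕ, z * (x ^ m * star x ^ n) ∈ M) (a : A) (ha : a ∈ M) :
      z * a ∈ M := by
    induction ha using Submodule.span_induction with
    | mem a ha => obtain ⟨p, rfl⟩ := ha; exact hz _ _
    | zero => simp
    | add a b _ _ ha hb => rw [mul_add]; exact add_mem ha hb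
    | smul c a _ ha => rw [mul_smul_comm]; exact M.smul_mem c ha
  have left (a : A) (ha : a ∈ M) : x * a ∈ M := key x (fun m n => by
    rw [← mul_assoc, ← pow_succ']; exact mem _ _) a ha
  have left_star (a : A) (ha : a ∈ M) : star x * a ∈ M := key (star x) (fun m n => by
    cases m with
    | zero => simpa [← pow_succ'] using mem 0 (n + 1)
    | succ m => rw [pow_succ', ← mul_assoc, ← mul_assoc, hx, one_mul]; exact mem _ _) a ha
  intro y hy
  have h1 : ∀ a ∈ M, y * a ∈ M := by
    rw [SetLike.mem_coe, ← StarSubalgebra.mem_toSubalgebra, StarAlgebra.adjoin_toSubalgebra] at hy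
    induction hy using Algebra.adjoin_induction with
    | mem u hu =>
      obtain rfl | hu : u = x ∨ star u = x := by simpa using hu
      · exact left
      · obtain rfl : u = star x := by rw [← hu, star_star]
        exact left_star
    | algebraMap r => intro a ha; rw [← Algebra.smul_def]; exact M.smul_mem r ha
    | add u v _ _ hu hv => intro a ha; rw [add_mul]; exact add_mem (hu a ha) (hv a ha)
    | mul u v _ _ hu hv => intro a ha; rw [mul_assoc]; exact hu _ (hv a ha)
  simpa using h1 1 (by simpa using mem 0 0)

/-- If contractive linear maps send `wᵐ w⋆ⁿ` to `(r x)ᵐ (r x)⋆ⁿ` for all `r < 1`, then in the limit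
`r → 1` every ⋆-polynomial has norm at `x` at most its norm at `w`. -/
theorem norm_snd_le_norm_fst_of_poisson {w : A} {x : B} (hw : star w * w = 1)
    (hx : star x * x = 1)
    (hΦ : ∀ r : ℝ, 0 < r → r < 1 → ∃ Φ : A →ₗ[ℂ] B, (∀ a, ‖Φ a‖ ≤ ‖a‖) ∧
      ∀ m n : ℕ, Φ (w ^ m * star w ^ n) = (r : ℂ) ^ (m + n) • (x ^ m * star x ^ n))
    {c : A × B} (hc : c ∈ StarAlgebra.elemental ℂ (w, x)) : ‖c.2‖ ≤ ‖c.1‖ := by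
  have hcl : IsClosed {c : A × B | ‖c.2‖ ≤ ‖c.1‖} :=
    isClosed_le continuous_snd.norm continuous_fst.norm
  refine closure_minimal (fun c hc => ?_) hcl hc
  replace hc := StarAlgebra.adjoin_singleton_le_span_of_isometry (x := (w, x))
    (by ext <;> simp [hw, hx]) hc
  choose! Φ hΦ1 hΦ2 using hΦ
  have hne : (nhdsWithin (1 : ℝ) (Set.Ioo 0 1)).NeBot := by
    rw [← mem_closure_iff_nhdsWithin_neBot, closure_Ioo (by norm_num)]; simp
  -- Convergence is preserved by linear combinations, so it suffices to check it on monomials.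
  have hlim : Filter.Tendsto (fun r : ℝ => Φ r c.1) (nhdsWithin 1 (Set.Ioo 0 1)) (nhds c.2) := by
    induction hc using Submodule.span_induction with
    | mem c hc =>
      obtain ⟨⟨m, n⟩, rfl⟩ := hc
      have h : Filter.Tendsto (fun r : ℝ => (r : ℂ) ^ (m + n) • (x ^ m * star x ^ n))
          (nhdsWithin 1 (Set.Ioo 0 1)) (nhds (x ^ m * star x ^ n)) := by
        refine Filter.Tendsto.mono_left ?_ nhdsWithin_le_nhds
        have : Continuous fun r : ℝ => (r : ℂ) ^ (m + n) • (x ^ m * star x ^ n) := by fun_prop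
        simpa using this.tendsto 1
      refine h.congr' ?_
      filter_upwards [self_mem_nhdsWithin] with r hr
      simpa using (hΦ2 r hr.1 hr.2 m n).symm
    | zero => simp
    | add a b _ _ ha hb => simpa using ha.add hb
    | smul c a _ ha => simpa using ha.const_smul c
  refine le_of_tendsto hlim.norm ?_
  filter_upwards [self_mem_nhdsWithin] with r hr
  exact hΦ1 r hr.1 hr.2 _

/-- If second components are dominated by first components in the C⋆-algebra generated by `(w, x)`,
then this algebra is the graph of a ⋆-homomorphism on the C⋆-algebra generated by `w`. -/
theorem StarAlgebra.elemental.exists_starAlgHom_of_norm_le {w : A} {x : B}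
    (h : ∀ c ∈ StarAlgebra.elemental ℂ (w, x), ‖c.2‖ ≤ ‖c.1‖) :
    ∃ ρ : StarAlgebra.elemental ℂ w →⋆ₐ[ℂ] B,
      ρ ⟨w, StarAlgebra.elemental.self_mem ℂ w⟩ = x := by
  set C := StarAlgebra.elemental ℂ (w, x)
  let p : C →⋆ₐ[ℂ] A := (StarAlgHom.fst ℂ A B).comp C.subtype
  have hp : Function.Injective p := by
    refine (injective_iff_map_eq_zero p).2 fun c hc => ?_
    have h1 : (c : A × B).1 = 0 := hc
    have h2 := h c c.2
    rw [h1, norm_zero, norm_le_zero_iff] at h2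
    exact Subtype.ext (Prod.ext h1 h2)
  -- An injective ⋆-homomorphism of C⋆-algebras is isometric, so its range is closed.
  have hclosed : IsClosed (p.range : Set A) :=
    (NonUnitalStarAlgHom.isometry p hp).isClosedEmbedding.isClosed_range
  have hle : StarAlgebra.elemental ℂ w ≤ p.range :=
    StarAlgebra.elemental.le_of_mem hclosed ⟨⟨(w, x), StarAlgebra.elemental.self_mem ℂ _⟩, rfl⟩
  let e := StarAlgEquiv.ofInjective p hp
  let s : C →⋆ₐ[ℂ] B := (StarAlgHom.snd ℂ A B).comp C.subtype
  refine ⟨(s.comp e.symm.toStarAlgHom).comp (StarSubalgebra.inclusion hle), ?_⟩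
  have : e.symm (StarSubalgebra.inclusion hle ⟨w, StarAlgebra.elemental.self_mem ℂ w⟩) =
      ⟨(w, x), StarAlgebra.elemental.self_mem ℂ _⟩ := by
    rw [StarAlgEquiv.symm_apply_eq]; rfl
  exact congrArg s this
end

/-! ### Direct sums of copies of a Hilbert space -/

section amplification
variable {H : Type*} [NormedAddCommGroup H] [InnerProductSpace ℂ H] [CompleteSpace H]

/-- The diagonal representation of the bounded operators on `H` on the direct sum of copies of `H`
indexed by `ι`. -/
def lpDiagonal (H ι : Type*) [NormedAddCommGroup H] [InnerProductSpace ℂ H] [CompleteSpace H] :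
    (H →L[ℂ] H) →⋆ₐ[ℂ] (lp (fun _ : ι => H) 2 →L[ℂ] lp (fun _ : ι => H) 2) where
  toFun T := lp.mapCLM 2 (fun _ => T) (norm_nonneg T) (fun _ => le_rfl)
  map_one' := by ext; simp
  map_mul' _ _ := by ext; simp
  map_zero' := by ext; simp
  map_add' _ _ := by ext; simp
  commutes' _ := by ext; simp [Algebra.algebraMap_eq_smul_one]
  map_star' T := by
    rw [ContinuousLinearMap.star_eq_adjoint, ContinuousLinearMap.star_eq_adjoint,
      ContinuousLinearMap.eq_adjoint_iff]
    intro x y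
    simp [lp.inner_eq_tsum, ContinuousLinearMap.adjoint_inner_left]

omit [CompleteSpace H] in
theorem HilbertBasis.hasSum_norm_inner_sq {ι : Type*} (b : HilbertBasis ι ℂ H) (x : H) :
    HasSum (fun i => ‖inner ℂ (b i) x‖ ^ 2) (‖x‖ ^ 2) := by
  have h := lp.hasSum_norm (p := 2) (by simp) (b.repr x)
  simpa [b.repr_apply_apply] using h

omit [CompleteSpace H] in
/-- Parseval's identity summed over a sequence of vectors, with the two summations exchanged. -/
theorem HilbertBasis.hasSum_tsum_norm_inner_sq {ι : Type*} (b : HilbertBasis ι ℂ H) {v : ℕ → H}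
    {s : ℝ} (hv : HasSum (fun n => ‖v n‖ ^ 2) s) :
    (∀ i, Summable fun n => ‖inner ℂ (b i) (v n)‖ ^ 2) ∧
      HasSum (fun i => ∑' n, ‖inner ℂ (b i) (v n)‖ ^ 2) s := by
  have hs : Summable fun p : ℕ × ι => ‖inner ℂ (b p.2) (v p.1)‖ ^ 2 := by
    refine (summable_prod_of_nonneg fun _ => by positivity).2
      ⟨fun n => (b.hasSum_norm_inner_sq (v n)).summable, ?_⟩
    simpa only [(b.hasSum_norm_inner_sq (v _)).tsum_eq] using hv.summable
  have h2 : HasSum (fun p : ι × ℕ => ‖inner ℂ (b p.1) (v p.2)‖ ^ 2) s := by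
    have h1 := hs.hasSum.prod_fiberwise fun n => b.hasSum_norm_inner_sq (v n)
    rw [← h1.unique hv]
    exact (Equiv.prodComm ι ℕ).hasSum_iff.2 hs.hasSum
  exact ⟨h2.summable.prod_factor, h2.prod_fiberwise fun i => (h2.summable.prod_factor i).hasSum⟩

theorem lp.hasSum_norm_sq {ι : Type*} {E : ι → Type*} [∀ i, NormedAddCommGroup (E i)]
    (x : lp E 2) : HasSum (fun i => ‖x i‖ ^ 2) (‖x‖ ^ 2) := by
  simpa using lp.hasSum_norm (p := 2) (by simp) x

theorem memℓp_two_of_summable {ι : Type*} {E : ι → Type*} [∀ i, NormedAddCommGroup (E i)]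
    {x : ∀ i, E i} (hx : Summable fun i => ‖x i‖ ^ 2) : Memℓp x 2 :=
  memℓp_gen (by simpa using hx)

/-- The isometry `ℓ²(ℕ, H) → ℓ²(ι, ℓ²(ℕ))` that takes coordinates with respect to a Hilbert basis
of `H` indexed by `ι` and exchanges the two indices: the matrix with rows indexed by `n : ℕ` is
transposed. -/
def HilbertBasis.transpose {ι : Type*} (b : HilbertBasis ι ℂ H) :
    lp (fun _ : ℕ => H) 2 →ₗᵢ[ℂ] lp (fun _ : ι => EllTwo) 2 :=
  let row (x : lp (fun _ : ℕ => H) 2) (i : ι) : EllTwo :=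
    ⟨fun n => inner ℂ (b i) (x n), memℓp_two_of_summable
      ((b.hasSum_tsum_norm_inner_sq (lp.hasSum_norm_sq x)).1 i)⟩
  have norm_row (x : lp (fun _ : ℕ => H) 2) : HasSum (fun i => ‖row x i‖ ^ 2) (‖x‖ ^ 2) := by
    convert (b.hasSum_tsum_norm_inner_sq (lp.hasSum_norm_sq x)).2 with i
    exact (lp.hasSum_norm_sq (row x i)).tsum_eq.symm
  { toFun x := ⟨row x, memℓp_two_of_summable (norm_row x).summable⟩
    map_add' x y := by
      ext i n
      exact inner_add_right _ _ _
    map_smul' c x := by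
      ext i n
      exact inner_smul_right _ _ _
    norm_map' x := by
      refine (sq_eq_sq₀ (norm_nonneg _) (norm_nonneg _)).1 ?_
      exact (lp.hasSum_norm_sq _).unique (norm_row x) }

end amplification

/-! ### The Poisson transform -/

theorem star_unilateralShift_apply (x : EllTwo) (n : ℕ) :
    (star unilateralShift x : EllTwo) n = x (n + 1) := by
  have h : inner ℂ (lp.single 2 n (1 : ℂ) : EllTwo) (star unilateralShift x) =
      inner ℂ (lp.single 2 (n + 1) (1 : ℂ) : EllTwo) x := by
    rw [ContinuousLinearMap.star_eq_adjoint, ContinuousLinearMap.adjoint_inner_right,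
      unilateralShift_single]
  simpa [lp.inner_single_left] using h

theorem star_unilateralShift_mul_self : star unilateralShift * unilateralShift = 1 := by
  ext x n
  exact star_unilateralShift_apply _ n

section poisson
variable {H : Type*} [NormedAddCommGroup H] [InnerProductSpace ℂ H] [CompleteSpace H]

/-- A contraction `T` has a defect operator `D = (1 - T T⋆)^{1/2}`; only the norm identity matters,
which characterizes `D⋆ D`. -/
theorem exists_defect_operator {T : H →L[ℂ] H} (hT : ‖T‖ ≤ 1) :
    ∃ D : H →L[ℂ] H, ∀ x, ‖D x‖ ^ 2 = ‖x‖ ^ 2 - ‖star T x‖ ^ 2 := by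
  have h0 : 0 ≤ 1 - T * star T := by
    rw [sub_nonneg]
    have := CStarAlgebra.mul_star_le_algebraMap_norm_sq (a := T)
    refine this.trans ?_
    rw [← map_one (algebraMap ℝ (H →L[ℂ] H))]
    exact algebraMap_mono _ (by nlinarith [norm_nonneg T])
  refine ⟨CFC.sqrt (1 - T * star T), fun x => ?_⟩
  have h1 : star (CFC.sqrt (1 - T * star T)) * CFC.sqrt (1 - T * star T) = 1 - T * star T := by
    rw [(IsSelfAdjoint.of_nonneg (CFC.sqrt_nonneg _)).star_eq, CFC.sqrt_mul_sqrt_self _ h0]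
  have h2 := ContinuousLinearMap.apply_norm_sq_eq_inner_adjoint_left (CFC.sqrt (1 - T * star T)) x
  have h3 := ContinuousLinearMap.apply_norm_sq_eq_inner_adjoint_left (star T) x
  rw [← ContinuousLinearMap.star_eq_adjoint] at h2 h3
  rw [← ContinuousLinearMap.mul_def] at h2 h3
  rw [h2, h3, h1, star_star, _root_.sub_apply, inner_sub_left, map_sub]
  exact congrArg (· - _) (inner_self_eq_norm_sq (𝕜 := ℂ) x)

/-- The series telescopes, and its remainder `‖T⋆ⁿ x‖²` tends to zero. -/
theorem hasSum_norm_defect_sq {T D : H →L[ℂ] H} (hT : ‖T‖ < 1)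
    (hD : ∀ x, ‖D x‖ ^ 2 = ‖x‖ ^ 2 - ‖star T x‖ ^ 2) (x : H) :
    HasSum (fun n : ℕ => ‖D ((star T ^ n) x)‖ ^ 2) (‖x‖ ^ 2) := by
  rw [hasSum_iff_tendsto_nat_of_nonneg fun _ => by positivity]
  have h (n : ℕ) : ∑ k ∈ Finset.range n, ‖D ((star T ^ k) x)‖ ^ 2 =
      ‖x‖ ^ 2 - ‖(star T ^ n) x‖ ^ 2 := by
    induction n with
    | zero => simp
    | succ n ih =>
      rw [Finset.sum_range_succ, ih, hD, pow_succ' (star T), mul_apply_eq_comp]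
      ring
  have h0 : Filter.Tendsto (fun n : ℕ => star T ^ n) Filter.atTop (nhds 0) :=
    tendsto_pow_atTop_nhds_zero_of_norm_lt_one (by rwa [norm_star])
  have h1 : Filter.Tendsto (fun n : ℕ => (star T ^ n) x) Filter.atTop (nhds 0) := by
    have := ((ContinuousLinearMap.apply ℂ H x).continuous.tendsto 0).comp h0
    rwa [map_zero] at this
  simp only [h]
  simpa using (h1.norm.pow 2).const_sub (‖x‖ ^ 2)

/-- The Poisson kernel `x ↦ (D T⋆ⁿ x)ₙ` of a strict contraction `T` with defect operator `D`. -/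
def contractionPoissonKernel {T D : H →L[ℂ] H} (hT : ‖T‖ < 1)
    (hD : ∀ x, ‖D x‖ ^ 2 = ‖x‖ ^ 2 - ‖star T x‖ ^ 2) : H →ₗᵢ[ℂ] lp (fun _ : ℕ => H) 2 where
  toFun x := ⟨fun n => D ((star T ^ n) x),
    memℓp_two_of_summable (hasSum_norm_defect_sq hT hD x).summable⟩
  map_add' x y := by
    ext n
    exact (congrArg D (map_add _ _ _)).trans (map_add _ _ _)
  map_smul' c x := by
    ext n
    exact (congrArg D (map_smul _ _ _)).trans (map_smul _ _ _)
  norm_map' x := by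
    refine (sq_eq_sq₀ (norm_nonneg _) (norm_nonneg _)).1 ?_
    exact (lp.hasSum_norm_sq _).unique (hasSum_norm_defect_sq hT hD x)

/-- The Poisson transform of a strict contraction `T`: a contractive linear map on the bounded
operators on `ℓ²(ℕ)` that sends `Wᵐ W⋆ⁿ` to `Tᵐ T⋆ⁿ`. -/
theorem exists_poissonTransform {T : H →L[ℂ] H} (hT : ‖T‖ < 1) :
    ∃ Φ : (EllTwo →L[ℂ] EllTwo) →ₗ[ℂ] (H →L[ℂ] H), (∀ a, ‖Φ a‖ ≤ ‖a‖) ∧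
      ∀ m n : ℕ, Φ (unilateralShift ^ m * star unilateralShift ^ n) = T ^ m * star T ^ n := by
  obtain ⟨D, hD⟩ := exists_defect_operator hT.le
  obtain ⟨ι, b, -⟩ := exists_hilbertBasis ℂ H
  let K : H →L[ℂ] lp (fun _ : ι => EllTwo) 2 :=
    (b.transpose.comp (contractionPoissonKernel hT hD)).toContinuousLinearMap
  let δ := lpDiagonal EllTwo ι
  have hK : ContinuousLinearMap.adjoint K ∘L K = 1 :=
    (b.transpose.comp (contractionPoissonKernel hT hD)).adjoint_comp_self
  have hKnorm : ‖K‖ ≤ 1 := LinearIsometry.norm_toContinuousLinearMap_le _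
  -- Shifting the sequence `(D T⋆ⁿ x)ₙ` backwards amounts to replacing `x` by `T⋆ x`.
  have h1 : star (δ unilateralShift) ∘L K = K ∘L star T := by
    rw [← map_star]
    ext x i n
    change (star unilateralShift (K x i) : EllTwo) n = K (star T x) i n
    rw [star_unilateralShift_apply]
    change inner ℂ (b i) (D ((star T ^ (n + 1)) x)) = inner ℂ (b i) (D ((star T ^ n) (star T x)))
    rw [pow_succ]; rfl
  have h2 : ContinuousLinearMap.adjoint K ∘L δ unilateralShift =
      T ∘L ContinuousLinearMap.adjoint K := by
    have := congrArg ContinuousLinearMap.adjoint h1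
    simpa [ContinuousLinearMap.adjoint_comp, ContinuousLinearMap.star_eq_adjoint] using this
  have h1n (n : ℕ) : (star (δ unilateralShift) ^ n) ∘L K = K ∘L (star T ^ n) := by
    induction n with
    | zero => rfl
    | succ n ih =>
      rw [pow_succ, pow_succ', ContinuousLinearMap.mul_def, ContinuousLinearMap.mul_def,
        ContinuousLinearMap.comp_assoc, h1, ← ContinuousLinearMap.comp_assoc, ih,
        ContinuousLinearMap.comp_assoc, ← ContinuousLinearMap.mul_def,
        ← ContinuousLinearMap.mul_def, ← pow_succ, ← pow_succ']
  have h2n (n : ℕ) : ContinuousLinearMap.adjoint K ∘L (δ unilateralShift ^ n) =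
      (T ^ n) ∘L ContinuousLinearMap.adjoint K := by
    induction n with
    | zero => rfl
    | succ n ih =>
      rw [pow_succ, pow_succ, ContinuousLinearMap.mul_def, ContinuousLinearMap.mul_def,
        ← ContinuousLinearMap.comp_assoc, ih, ContinuousLinearMap.comp_assoc, h2,
        ContinuousLinearMap.comp_assoc]
  refine ⟨⟨⟨fun a => ContinuousLinearMap.adjoint K ∘L δ a ∘L K, fun a c => ?_⟩, fun c a => ?_⟩,
    fun a => ?_, fun m n => ?_⟩
  · simp
  · simp
  · change ‖ContinuousLinearMap.adjoint K ∘L δ a ∘L K‖ ≤ ‖a‖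
    refine ContinuousLinearMap.opNorm_le_bound _ (norm_nonneg a) fun x => ?_
    have hK' : ‖ContinuousLinearMap.adjoint K‖ ≤ 1 := by
      rwa [LinearIsometryEquiv.norm_map]
    have hδ : ‖δ a‖ ≤ ‖a‖ := NonUnitalStarAlgHom.norm_apply_le δ a
    calc ‖ContinuousLinearMap.adjoint K (δ a (K x))‖ ≤ 1 * (‖a‖ * (1 * ‖x‖)) :=
          (ContinuousLinearMap.le_of_opNorm_le _ hK' _).trans <| by
            gcongr
            refine (ContinuousLinearMap.le_of_opNorm_le _ hδ _).trans ?_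
            gcongr
            exact ContinuousLinearMap.le_of_opNorm_le _ hKnorm _
      _ = ‖a‖ * ‖x‖ := by ring
  · change ContinuousLinearMap.adjoint K ∘L δ (unilateralShift ^ m * star unilateralShift ^ n) ∘L K
      = T ^ m * star T ^ n
    rw [map_mul, map_pow, map_pow, map_star, ContinuousLinearMap.mul_def,
      ContinuousLinearMap.comp_assoc, h1n, ← ContinuousLinearMap.comp_assoc, h2n,
      ContinuousLinearMap.comp_assoc,
      ← ContinuousLinearMap.comp_assoc (ContinuousLinearMap.adjoint K), hK]
    rfl
end poisson

/-! ### Generators of C⋆-algebras -/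

namespace StarSubalgebra

/-- Induction on generators for the closed ⋆-algebra generated by a set. -/
theorem eq_top_of_isClosed_of_generators_mem {A : Type*} [CStarAlgebra A] {s : Set A}
    {S : StarSubalgebra ℂ (StarAlgebra.adjoin ℂ s).topologicalClosure}
    (hS : IsClosed (S : Set (StarAlgebra.adjoin ℂ s).topologicalClosure))
    (h : ∀ x, ∀ hx : x ∈ s, ⟨x, le_topologicalClosure _ (StarAlgebra.subset_adjoin ℂ s hx)⟩ ∈ S) :
    S = ⊤ := by
  have hcl : IsClosed (S.map (subtype _) : Set A) :=
    (isClosed_topologicalClosure (StarAlgebra.adjoin ℂ s)).isClosedEmbedding_subtypeVal.isClosedMap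
      _ hS
  have hle : (StarAlgebra.adjoin ℂ s).topologicalClosure ≤ S.map (subtype _) :=
    topologicalClosure_minimal (StarAlgebra.adjoin_le fun x hx => ⟨_, h x hx, rfl⟩) hcl
  refine eq_top_iff.2 fun y => ?_
  obtain ⟨z, hz, hzy⟩ := hle y.2
  rwa [← Subtype.ext hzy]

theorem isClosed_comap {A B : Type*} [CStarAlgebra A] [CStarAlgebra B] (φ : A →⋆ₐ[ℂ] B)
    {S : StarSubalgebra ℂ B} (hS : IsClosed (S : Set B)) : IsClosed (S.comap φ : Set A) :=
  hS.preimage (map_continuous φ)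

theorem isClosed_equalizer {A B : Type*} [CStarAlgebra A] [CStarAlgebra B] (φ ψ : A →⋆ₐ[ℂ] B) :
    IsClosed (StarAlgHom.equalizer φ ψ : Set A) :=
  isClosed_eq (map_continuous φ) (map_continuous ψ)

end StarSubalgebra

/-! ### Coburn's theorem -/

theorem norm_real_smul_lt_one {B : Type*} [CStarAlgebra B] {x : B} (hx : star x * x = 1) {r : ℝ}
    (h0 : 0 < r) (h1 : r < 1) : ‖(r : ℂ) • x‖ < 1 := by
  rw [norm_smul, Complex.norm_real, Real.norm_of_nonneg h0.le]
  nlinarith [norm_le_one_of_star_mul_self_eq_one hx]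

namespace ToeplitzAlgebra

theorem eq_top_of_isClosed_of_W_mem {S : StarSubalgebra ℂ ToeplitzAlgebra}
    (hS : IsClosed (S : Set ToeplitzAlgebra)) (h : W ∈ S) : S = ⊤ :=
  StarSubalgebra.eq_top_of_isClosed_of_generators_mem (s := {unilateralShift}) (S := S) hS
    (by rintro _ rfl; exact h)

theorem hom_ext {B : Type*} [CStarAlgebra B] {φ ψ : ToeplitzAlgebra →⋆ₐ[ℂ] B}
    (h : φ W = ψ W) : φ = ψ := by
  have := eq_top_of_isClosed_of_W_mem (StarSubalgebra.isClosed_equalizer φ ψ) h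
  exact StarAlgHom.ext fun x => StarSubalgebra.eq_top_iff.1 this x

theorem star_W_mul_W : star W * W = 1 := Subtype.ext star_unilateralShift_mul_self

/-- Coburn's theorem: the Toeplitz algebra is the universal C⋆-algebra generated by an isometry.
The Poisson transforms of the strict contractions `r U` provide the required norm estimate. -/
theorem exists_starAlgHom_of_isometry {H : Type*} [NormedAddCommGroup H] [InnerProductSpace ℂ H]
    [CompleteSpace H] {U : H →L[ℂ] H} (hU : star U * U = 1) :
    ∃ ρ : ToeplitzAlgebra →⋆ₐ[ℂ] (H →L[ℂ] H), ρ W = U := by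
  refine StarAlgebra.elemental.exists_starAlgHom_of_norm_le fun c hc =>
    norm_snd_le_norm_fst_of_poisson star_unilateralShift_mul_self hU (fun r h0 h1 => ?_) hc
  obtain ⟨Φ, h, hΦ⟩ := exists_poissonTransform (norm_real_smul_lt_one hU h0 h1)
  refine ⟨Φ, h, fun m n => ?_⟩
  rw [hΦ, star_smul, smul_pow, smul_pow, smul_mul_smul_comm, pow_add]
  simp

end ToeplitzAlgebra

/-! ### The rotation action -/

/-- The phase `exp (2 π i n θ)`. -/
def rotationPhase (θ : ℝ) (n : ℤ) : ℂ := Complex.exp (2 * Real.pi * Complex.I * n * θ)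

theorem rotationPhase_zero (θ : ℝ) : rotationPhase θ 0 = 1 := by simp [rotationPhase]

theorem rotationPhase_one (θ : ℝ) :
    rotationPhase θ 1 = Complex.exp (2 * Real.pi * Complex.I * θ) := by simp [rotationPhase]

theorem rotationPhase_add (θ : ℝ) (m n : ℤ) :
    rotationPhase θ (m + n) = rotationPhase θ m * rotationPhase θ n := by
  rw [rotationPhase, rotationPhase, rotationPhase, ← Complex.exp_add]
  push_cast; ring_nf

theorem star_rotationPhase (θ : ℝ) (n : ℤ) : star (rotationPhase θ n) = rotationPhase θ (-n) := by
  rw [rotationPhase, rotationPhase, Complex.star_def, ← Complex.exp_conj]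
  simp [Complex.conj_ofNat]

theorem star_rotationPhase_mul_self (θ : ℝ) (n : ℤ) :
    star (rotationPhase θ n) * rotationPhase θ n = 1 := by
  rw [star_rotationPhase, ← rotationPhase_add, neg_add_cancel, rotationPhase_zero]

theorem zpow_mul_eq_rotationPhase_smul {B : Type*} [CStarAlgebra B] {θ : ℝ} {x : B}
    (v : unitary B) (h : (v : B) * x = rotationPhase θ 1 • (x * v)) (n : ℤ) :
    ((v ^ n : unitary B) : B) * x = rotationPhase θ n • (x * (v ^ n : unitary B)) := by
  -- Multiply the hypothesis by `v⁻¹` on both sides.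
  have hinv : ((v⁻¹ : unitary B) : B) * x = rotationPhase θ (-1) • (x * (v⁻¹ : unitary B)) := by
    have h1 : (v : B) * (v⁻¹ : unitary B) = 1 := Unitary.mul_star_self_of_mem v.2
    have h2 : ((v⁻¹ : unitary B) : B) * v = 1 := Unitary.star_mul_self_of_mem v.2
    calc ((v⁻¹ : unitary B) : B) * x
        = rotationPhase θ (-1 + 1) • (((v⁻¹ : unitary B) : B) * x * (v * (v⁻¹ : unitary B))) := by
          simp [h1, rotationPhase_zero]
      _ = rotationPhase θ (-1) • (((v⁻¹ : unitary B) : B) * (rotationPhase θ 1 • (x * v)) *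
            (v⁻¹ : unitary B)) := by
          rw [rotationPhase_add, mul_smul]; simp [mul_assoc]
      _ = _ := by rw [← h, ← mul_assoc, h2, one_mul]
  induction n with
  | zero => simp [rotationPhase_zero]
  | succ n ih =>
    rw [zpow_add_one, Submonoid.coe_mul, mul_assoc, h, mul_smul_comm, ← mul_assoc, ih,
      smul_mul_assoc, smul_smul, mul_assoc, add_comm (n : ℤ), rotationPhase_add]
  | pred n ih =>
    rw [zpow_sub_one, Submonoid.coe_mul, mul_assoc, hinv, mul_smul_comm, ← mul_assoc, ih,
      smul_mul_assoc, smul_smul, mul_assoc, sub_eq_add_neg, add_comm (-(n : ℤ)), rotationPhase_add]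

namespace ToeplitzAlgebra

theorem exists_rotation (θ : ℝ) (n : ℤ) :
    ∃ φ : ToeplitzAlgebra →⋆ₐ[ℂ] ToeplitzAlgebra, φ W = rotationPhase θ n • W := by
  obtain ⟨ρ, hρ⟩ := exists_starAlgHom_of_isometry (U := rotationPhase θ n • unilateralShift) (by
    rw [star_smul, smul_mul_smul_comm, star_rotationPhase_mul_self, star_unilateralShift_mul_self,
      one_smul])
  have hmem : (StarAlgebra.elemental ℂ unilateralShift).comap ρ = ⊤ := by
    refine eq_top_of_isClosed_of_W_mem
      (StarSubalgebra.isClosed_comap ρ (StarAlgebra.elemental.isClosed ℂ _)) ?_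
    change ρ W ∈ StarAlgebra.elemental ℂ unilateralShift
    rw [hρ]
    exact SMulMemClass.smul_mem _ (StarAlgebra.elemental.self_mem ℂ _)
  exact ⟨ρ.codRestrict (StarAlgebra.elemental ℂ unilateralShift)
    fun x => StarSubalgebra.eq_top_iff.1 hmem x, Subtype.ext hρ⟩

/-- The endomorphism of the Toeplitz algebra that multiplies `W` by `exp (2 π i n θ)`. -/
def rotationHom (θ : ℝ) (n : ℤ) : ToeplitzAlgebra →⋆ₐ[ℂ] ToeplitzAlgebra :=
  (exists_rotation θ n).choose

theorem rotationHom_W (θ : ℝ) (n : ℤ) : rotationHom θ n W = rotationPhase θ n • W :=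
  (exists_rotation θ n).choose_spec

theorem rotationHom_zero (θ : ℝ) : rotationHom θ 0 = StarAlgHom.id ℂ ToeplitzAlgebra :=
  hom_ext (by simp [rotationHom_W, rotationPhase_zero])

theorem rotationHom_comp (θ : ℝ) (m n : ℤ) :
    (rotationHom θ m).comp (rotationHom θ n) = rotationHom θ (m + n) :=
  hom_ext (by
    rw [StarAlgHom.comp_apply, rotationHom_W, map_smul, rotationHom_W, rotationHom_W, smul_smul,
      mul_comm, rotationPhase_add])

/-- The rotation action of angle `θ` of `ℤ` on the Toeplitz algebra. -/
def rotation (θ : ℝ) : Multiplicative ℤ →* (ToeplitzAlgebra ≃⋆ₐ[ℂ] ToeplitzAlgebra) where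
  toFun g := StarAlgEquiv.ofStarAlgHom (rotationHom θ g.toAdd) (rotationHom θ (-g.toAdd))
    (by rw [rotationHom_comp, neg_add_cancel, rotationHom_zero])
    (by rw [rotationHom_comp, add_neg_cancel, rotationHom_zero])
  map_one' := by
    ext x
    exact DFunLike.congr_fun (rotationHom_zero θ) x
  map_mul' g h := by
    ext x
    exact (DFunLike.congr_fun (rotationHom_comp θ g.toAdd h.toAdd) x).symm

end ToeplitzAlgebra

theorem isToeplitzRotation_rotation (θ : ℝ) :
    IsToeplitzRotation θ (ToeplitzAlgebra.rotation θ) :=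
  fun n => ToeplitzAlgebra.rotationHom_W θ n

theorem IsToeplitzRotation.unique {θ : ℝ}
    {Θ Θ' : Multiplicative ℤ →* (ToeplitzAlgebra ≃⋆ₐ[ℂ] ToeplitzAlgebra)}
    (h : IsToeplitzRotation θ Θ) (h' : IsToeplitzRotation θ Θ') : Θ = Θ' := by
  refine MonoidHom.ext fun g => StarAlgEquiv.ext fun x => ?_
  have : (Θ g).toStarAlgHom = (Θ' g).toStarAlgHom :=
    ToeplitzAlgebra.hom_ext ((h g.toAdd).trans (h' g.toAdd).symm)
  exact DFunLike.congr_fun this x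

/-! ### Representations of the solid torus and covariant representations -/

namespace CrossedProduct

section
variable {A G : Type u} [CStarAlgebra A] [Group G] (α : G →* (A ≃⋆ₐ[ℂ] A))

/-- The canonical map `A → A ⋊_α G` as a ⋆-homomorphism. -/
def ofStarAlgHom : A →⋆ₐ[ℂ] CrossedProduct α where
  toFun := of α
  map_one' := Subtype.ext <| Subtype.ext <| funext fun π => map_one π.ρ
  map_mul' a b := Subtype.ext <| Subtype.ext <| funext fun π => map_mul π.ρ a b
  map_zero' := Subtype.ext <| Subtype.ext <| funext fun π => map_zero π.ρ
  map_add' a b := Subtype.ext <| Subtype.ext <| funext fun π => map_add π.ρ a b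
  commutes' c := Subtype.ext <| Subtype.ext <| funext fun π => AlgHomClass.commutes π.ρ c
  map_star' a := Subtype.ext <| Subtype.ext <| funext fun π => map_star π.ρ a

theorem implementer_mul (g h : G) :
    implementer α (g * h) = implementer α g * implementer α h :=
  Subtype.ext <| Subtype.ext <| funext fun π => congrArg Subtype.val (map_mul π.V g h)

theorem implementer_one : implementer α 1 = 1 :=
  Subtype.ext <| Subtype.ext <| funext fun π => congrArg Subtype.val (map_one π.V)

theorem implementer_inv (g : G) : implementer α g⁻¹ = star (implementer α g) :=
  Subtype.ext <| Subtype.ext <| funext fun π => congrArg Subtype.val (map_inv π.V g)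

end

/-- The crossed product of the Toeplitz algebra by `ℤ` is generated by `W` and the implementer of
the generator of `ℤ`. -/
theorem eq_top_of_isClosed_of_mem
    {Θ : Multiplicative ℤ →* (ToeplitzAlgebra ≃⋆ₐ[ℂ] ToeplitzAlgebra)}
    {S : StarSubalgebra ℂ (CrossedProduct Θ)} (hS : IsClosed (S : Set (CrossedProduct Θ)))
    (hW : of Θ ToeplitzAlgebra.W ∈ S) (hV : implementer Θ (Multiplicative.ofAdd 1) ∈ S) :
    S = ⊤ := by
  refine StarSubalgebra.eq_top_of_isClosed_of_generators_mem
    (s := Set.range (ambientOf Θ) ∪ Set.range (ambientUnitary Θ)) (S := S) hS ?_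
  rintro _ (⟨a, rfl⟩ | ⟨g, rfl⟩)
  · have h := ToeplitzAlgebra.eq_top_of_isClosed_of_W_mem
      (StarSubalgebra.isClosed_comap (ofStarAlgHom Θ) hS) hW
    exact StarSubalgebra.eq_top_iff.1 h a
  · change implementer Θ g ∈ S
    have hnat (n : ℕ) : implementer Θ (Multiplicative.ofAdd (n : ℤ)) ∈ S := by
      induction n with
      | zero => exact (implementer_one Θ).symm ▸ one_mem S
      | succ n ih =>
        have : implementer Θ (Multiplicative.ofAdd ((n + 1 : ℕ) : ℤ)) =
            implementer Θ (Multiplicative.ofAdd (n : ℤ)) *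
              implementer Θ (Multiplicative.ofAdd 1) := by
          rw [← implementer_mul, ← ofAdd_add, Nat.cast_succ]
        rw [this]
        exact mul_mem ih hV
    obtain ⟨n, hn | hn⟩ := g.toAdd.eq_nat_or_neg
    · rw [← ofAdd_toAdd g, hn]
      exact hnat n
    · rw [← ofAdd_toAdd g, hn, ofAdd_neg, implementer_inv]
      exact star_mem (hnat n)

end CrossedProduct

theorem QuantumSolidTorus.eq_top_of_isClosed_of_mem {θ : ℝ}
    {S : StarSubalgebra ℂ (QuantumSolidTorus θ)} (hS : IsClosed (S : Set (QuantumSolidTorus θ)))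
    (hU : U θ ∈ S) (hV : V θ ∈ S) : S = ⊤ := by
  refine StarSubalgebra.eq_top_of_isClosed_of_generators_mem
    (s := {ambientU θ, ambientV θ}) (S := S) hS ?_
  rintro _ (rfl | rfl)
  · exact hU
  · exact hV

variable {θ : ℝ} {Θ : Multiplicative ℤ →* (ToeplitzAlgebra ≃⋆ₐ[ℂ] ToeplitzAlgebra)}

/-- A covariant representation `(ρ, V)` of a rotation action restricts to the pair `(ρ W, V 1)`. -/
def CovariantRep.toSolidTorusRep (hΘ : IsToeplitzRotation θ Θ) (π : CovariantRep Θ) :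
    SolidTorusRep θ where
  H := π.H
  U := π.ρ ToeplitzAlgebra.W
  V := π.V (Multiplicative.ofAdd 1)
  star_U_mul_U := by rw [← map_star, ← map_mul, ToeplitzAlgebra.star_W_mul_W, map_one]
  star_V_mul_V := Unitary.star_mul_self_of_mem (π.V _).2
  V_mul_star_V := Unitary.mul_star_self_of_mem (π.V _).2
  V_mul_U := by
    have h := π.covariant (Multiplicative.ofAdd 1) ToeplitzAlgebra.W
    have h1 : Θ (Multiplicative.ofAdd 1) ToeplitzAlgebra.W =
        Complex.exp (2 * Real.pi * Complex.I * θ) • ToeplitzAlgebra.W := by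
      simpa using hΘ 1
    rw [h1, map_smul] at h
    rw [← smul_mul_assoc, h, mul_assoc, Unitary.star_mul_self_of_mem (π.V _).2, mul_one]

theorem SolidTorusRep.exists_starAlgHom (π : SolidTorusRep θ) :
    ∃ ρ : ToeplitzAlgebra →⋆ₐ[ℂ] (π.H →L[ℂ] π.H), ρ ToeplitzAlgebra.W = π.U :=
  ToeplitzAlgebra.exists_starAlgHom_of_isometry π.star_U_mul_U

/-- A pair `(U, V)` as in the definition of `A_θ` extends to a covariant representation of a
rotation action, on the same Hilbert space: `𝒯` is represented through `W ↦ U`, and `n : ℤ` acts as `Vⁿ`.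
Covariance holds on the generator `W`, hence on `𝒯`. -/
def SolidTorusRep.toCovariantRep (hΘ : IsToeplitzRotation θ Θ) (π : SolidTorusRep θ) :
    CovariantRep Θ where
  H := π.H
  ρ := π.exists_starAlgHom.choose
  V := zpowersHom _ ⟨π.V, Unitary.mem_iff.2 ⟨π.star_V_mul_V, π.V_mul_star_V⟩⟩
  covariant g a := by
    set v : unitary (π.H →L[ℂ] π.H) := ⟨π.V, Unitary.mem_iff.2 ⟨π.star_V_mul_V, π.V_mul_star_V⟩⟩
    set ρ := π.exists_starAlgHom.choose
    have hρ : ρ ToeplitzAlgebra.W = π.U := π.exists_starAlgHom.choose_spec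
    have h : ρ.comp (Θ g).toStarAlgHom =
        (Unitary.conjStarAlgAut ℂ (π.H →L[ℂ] π.H) (v ^ g.toAdd)).toStarAlgHom.comp ρ := by
      refine ToeplitzAlgebra.hom_ext ?_
      change ρ (Θ (Multiplicative.ofAdd g.toAdd) ToeplitzAlgebra.W) =
        Unitary.conjStarAlgAut ℂ (π.H →L[ℂ] π.H) (v ^ g.toAdd) (ρ ToeplitzAlgebra.W)
      rw [hΘ, map_smul, hρ, Unitary.conjStarAlgAut_apply, zpow_mul_eq_rotationPhase_smul v
        (by rw [rotationPhase_one]; exact π.V_mul_U), smul_mul_assoc, mul_assoc π.U,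
        Unitary.mul_star_self_of_mem (v ^ g.toAdd).2, mul_one]
      rfl
    exact DFunLike.congr_fun h a

theorem SolidTorusRep.toCovariantRep_ρ_W (hΘ : IsToeplitzRotation θ Θ) (π : SolidTorusRep θ) :
    (π.toCovariantRep hΘ).ρ ToeplitzAlgebra.W = π.U :=
  π.exists_starAlgHom.choose_spec

theorem SolidTorusRep.toCovariantRep_V (hΘ : IsToeplitzRotation θ Θ) (π : SolidTorusRep θ) :
    ((π.toCovariantRep hΘ).V (Multiplicative.ofAdd 1)).1 = π.V :=
  congrArg Subtype.val (zpow_one _)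

/-- Restriction of bounded families along a map of the index sets. -/
def lpInftyReindex {I J : Type*} (B : I → Type*) [∀ i, CStarAlgebra (B i)] [∀ i, Nontrivial (B i)]
    (f : J → I) : lp B ∞ →⋆ₐ[ℂ] lp (fun j => B (f j)) ∞ where
  toFun x := ⟨fun j => x (f j), memℓp_infty ⟨‖x‖, by
    rintro _ ⟨j, rfl⟩
    exact lp.norm_apply_le_norm ENNReal.top_ne_zero x (f j)⟩⟩
  map_one' := rfl
  map_mul' _ _ := rfl
  map_zero' := rfl
  map_add' _ _ := rfl
  commutes' _ := rfl
  map_star' _ := rfl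

/-! ### The isomorphism -/

/-- Evaluation of bounded families of operators at the representations of the solid torus that come
from covariant representations. -/
def QuantumSolidTorus.ambientHom (hΘ : IsToeplitzRotation θ Θ) :
    QuantumSolidTorus.Ambient θ →⋆ₐ[ℂ] CrossedProduct.Ambient Θ :=
  lpInftyReindex (fun π : SolidTorusRep θ => π.H →L[ℂ] π.H) (CovariantRep.toSolidTorusRep hΘ)

/-- Evaluation of bounded families of operators at the covariant representations that come from
representations of the solid torus. -/
def CrossedProduct.ambientHom (hΘ : IsToeplitzRotation θ Θ) :
    CrossedProduct.Ambient Θ →⋆ₐ[ℂ] QuantumSolidTorus.Ambient θ :=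
  lpInftyReindex (fun π : CovariantRep Θ => π.H →L[ℂ] π.H) (SolidTorusRep.toCovariantRep hΘ)

theorem QuantumSolidTorus.exists_starAlgHom (hΘ : IsToeplitzRotation θ Θ) :
    ∃ φ : QuantumSolidTorus θ →⋆ₐ[ℂ] CrossedProduct Θ,
      φ (U θ) = CrossedProduct.of Θ ToeplitzAlgebra.W ∧
      φ (V θ) = CrossedProduct.implementer Θ (Multiplicative.ofAdd 1) := by
  let C : StarSubalgebra ℂ (CrossedProduct.Ambient Θ) := (StarAlgebra.adjoin ℂ
    (Set.range (CrossedProduct.ambientOf Θ) ∪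
      Set.range (CrossedProduct.ambientUnitary Θ))).topologicalClosure
  let A : StarSubalgebra ℂ (QuantumSolidTorus.Ambient θ) := (StarAlgebra.adjoin ℂ
    {QuantumSolidTorus.ambientU θ, QuantumSolidTorus.ambientV θ}).topologicalClosure
  let ψ : QuantumSolidTorus θ →⋆ₐ[ℂ] CrossedProduct.Ambient Θ := (ambientHom hΘ).comp A.subtype
  have hU : ψ (U θ) = CrossedProduct.ambientOf Θ ToeplitzAlgebra.W := rfl
  have hV : ψ (V θ) = CrossedProduct.ambientUnitary Θ (Multiplicative.ofAdd 1) := rfl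
  have h : C.comap ψ = ⊤ := eq_top_of_isClosed_of_mem
    (StarSubalgebra.isClosed_comap ψ (StarSubalgebra.isClosed_topologicalClosure _))
    (CrossedProduct.of Θ ToeplitzAlgebra.W).2
    (CrossedProduct.implementer Θ (Multiplicative.ofAdd 1)).2
  exact ⟨ψ.codRestrict C fun x => StarSubalgebra.eq_top_iff.1 h x, Subtype.ext hU, Subtype.ext hV⟩

theorem CrossedProduct.exists_starAlgHom (hΘ : IsToeplitzRotation θ Θ) :
    ∃ φ : CrossedProduct Θ →⋆ₐ[ℂ] QuantumSolidTorus θ,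
      φ (of Θ ToeplitzAlgebra.W) = QuantumSolidTorus.U θ ∧
      φ (implementer Θ (Multiplicative.ofAdd 1)) = QuantumSolidTorus.V θ := by
  let C : StarSubalgebra ℂ (CrossedProduct.Ambient Θ) := (StarAlgebra.adjoin ℂ
    (Set.range (CrossedProduct.ambientOf Θ) ∪
      Set.range (CrossedProduct.ambientUnitary Θ))).topologicalClosure
  let A : StarSubalgebra ℂ (QuantumSolidTorus.Ambient θ) := (StarAlgebra.adjoin ℂ
    {QuantumSolidTorus.ambientU θ, QuantumSolidTorus.ambientV θ}).topologicalClosure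
  let ψ : CrossedProduct Θ →⋆ₐ[ℂ] QuantumSolidTorus.Ambient θ := (ambientHom hΘ).comp C.subtype
  have hU : ψ (of Θ ToeplitzAlgebra.W) = QuantumSolidTorus.ambientU θ :=
    Subtype.ext <| funext fun π : SolidTorusRep θ => π.toCovariantRep_ρ_W hΘ
  have hV : ψ (implementer Θ (Multiplicative.ofAdd 1)) = QuantumSolidTorus.ambientV θ :=
    Subtype.ext <| funext fun π : SolidTorusRep θ => π.toCovariantRep_V hΘ
  have h : A.comap ψ = ⊤ := eq_top_of_isClosed_of_mem
    (StarSubalgebra.isClosed_comap ψ (StarSubalgebra.isClosed_topologicalClosure _))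
    (show ψ _ ∈ A from hU ▸ (QuantumSolidTorus.U θ).2)
    (show ψ _ ∈ A from hV ▸ (QuantumSolidTorus.V θ).2)
  exact ⟨ψ.codRestrict A fun x => StarSubalgebra.eq_top_iff.1 h x, Subtype.ext hU, Subtype.ext hV⟩

theorem mainTheorem5 (θ : ℝ) :
    (∃! Θ : Multiplicative ℤ →* (ToeplitzAlgebra ≃⋆ₐ[ℂ] ToeplitzAlgebra),
      IsToeplitzRotation θ Θ) ∧
    ∀ Θ : Multiplicative ℤ →* (ToeplitzAlgebra ≃⋆ₐ[ℂ] ToeplitzAlgebra),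
      IsToeplitzRotation θ Θ →
      ∃ φ : QuantumSolidTorus θ ≃⋆ₐ[ℂ] CrossedProduct Θ,
        φ (QuantumSolidTorus.U θ) = CrossedProduct.of Θ ToeplitzAlgebra.W ∧
        φ (QuantumSolidTorus.V θ) =
          CrossedProduct.implementer Θ (Multiplicative.ofAdd 1) := by
  refine ⟨⟨_, isToeplitzRotation_rotation θ, fun Θ hΘ =>
    hΘ.unique (isToeplitzRotation_rotation θ)⟩, fun Θ hΘ => ?_⟩
  obtain ⟨φ, hφU, hφV⟩ := QuantumSolidTorus.exists_starAlgHom hΘ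
  obtain ⟨ψ, hψU, hψV⟩ := CrossedProduct.exists_starAlgHom hΘ
  have h1 : ψ.comp φ = StarAlgHom.id ℂ (QuantumSolidTorus θ) := by
    have h := QuantumSolidTorus.eq_top_of_isClosed_of_mem
      (StarSubalgebra.isClosed_equalizer (ψ.comp φ) (StarAlgHom.id ℂ (QuantumSolidTorus θ)))
      ((congrArg ψ hφU).trans hψU) ((congrArg ψ hφV).trans hψV)
    exact StarAlgHom.ext fun x => StarSubalgebra.eq_top_iff.1 h x
  have h2 : φ.comp ψ = StarAlgHom.id ℂ (CrossedProduct Θ) := by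
    have h := CrossedProduct.eq_top_of_isClosed_of_mem
      (StarSubalgebra.isClosed_equalizer (φ.comp ψ) (StarAlgHom.id ℂ (CrossedProduct Θ)))
      ((congrArg φ hψU).trans hφU) ((congrArg φ hψV).trans hφV)
    exact StarAlgHom.ext fun x => StarSubalgebra.eq_top_iff.1 h x
  exact ⟨StarAlgEquiv.ofStarAlgHom φ ψ h1 h2, hφU, hφV⟩
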